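/- A *residuated lattice* is an algebra $\mathbf A=\langle A,\wedge,\vee,\cdot,\backslash,/,e\rangle$ such that $\langle A,\wedge,\vee\rangle$ is a lattice, $\langle A,\cdot,e\rangle$ is a monoid, and $b\le a\backslash c\iff a\cdot b\le c\iff a\le c/b$ for all $a,b,c\in A$. A *canonical extension* of a poset $P$ is a complete lattice $P^\sigma$ with an order embedding of $P$ (regarded as inclusion) that preserves all existing finite meets and joins of $P$, such that, calling meets (joins) in $P^\sigma$ of arbitrary subsets of $P$ *closed* (*open*), every element of $P^\sigma$ is both a join of closed elements and a meet of open elements, and, for any set $S$ of closed and any set $T$ of open elements, $\bigwedge S\le\bigvee T$ if and only if $\bigwedge S_0\le\bigvee T_0$ for some finite $S_0\subseteq S$, $T_0\subseteq T$. It is unique up to isomorphism. The canonical extension of a residuated lattice $\mathbf A$ is $\mathbf A^\sigma=\langle A^\sigma,\wedge,\vee,\cdot^\sigma,\backslash^\pi,/^\pi,e\rangle$, where $\wedge,\vee$ are the lattice operations of $A^\sigma$ and, with $p,r$ ranging over closed elements, $q$ over open elements and $a,b,c$ over $A$, $$x\cdot^\sigma y=\bigvee_{p\le x,\;r\le y}\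 \bigwedge\{ab \mid p\le a,\ r\le b\},$$ $$x\backslash^\pi z=\bigwedge_{p\le x,\;z\le q}\ \bigvee\{a\backslash c\mid p\le a,\ c\le q\},\qquad z/^\pi y=\bigwedge_{p\le y,\;z\le q}\ \bigvee\{c/b\mid p\le b,\ c\le q\}.$$ A class $\mathcal C$ of residuated lattices is *closed under canonical extensions* if for every $\mathbf A\in\mathcal C$ it contains, up to isomorphism, $\mathbf A^\sigma$. A variety $\mathcal V$ of residuated lattices (a class axiomatized by equations) is *coherent* if every finitely generated subalgebra of a finitely presented member of $\mathcal V$ is itself finitely presented (in $\mathcal V$). It is *Hamiltonian* if $\mathcal V\models (e\wedge x)^k y\approx y(e\wedge x)^k$ for some integer $k\ge 1$. It has *equationally definable principal congruences* (EDPC) if there are finitely many equations $s_i(x,y,z,w)\approx t_i(x,y,z,w)$ such that for all $\mathbf A\in\mathcal V$ and $a,b,c,d\in A$, the pair $\langle c,d\rangle$ belongs to the congruence of $\mathbf A$ generated by $\langle a,b\rangle$ if and only if $s_i^{\mathbf A}(a,b,c,d)=t_i^{\mathbf A}(a,b,c,d)$ for all $i$. **Theorem.** Let $\mathcal C$ be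 a class of residuated lattices that is closed under canonical extensions, and suppose that $\mathcal V=\mathbb{ISP}(\mathcal C)$, the class of isomorphic copies of subalgebras of direct products of members of $\mathcal C$, is a coherent variety. Then $\mathcal V\models(e\wedge x)^{n+1}\approx(e\wedge x)^n$ for some $n\in\mathbb N$ and, if $\mathcal V$ is also Hamiltonian, then $\mathcal V$ has EDPC. -/

import Mathlib

universe u

/-- A residuated lattice `⟨A, ∧, ∨, ·, \, /, e⟩`: a lattice and a monoid with
`b ≤ a \ c ↔ a · b ≤ c ↔ a ≤ c / b`.  No boundedness, commutativity or integrality is assumed.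
The monoid unit `e` is `1`; `ldiv a c` is `a \ c` and `rdiv c b` is `c / b`. -/
class ResiduatedLattice (A : Type*) extends Lattice A, Monoid A where
  ldiv : A → A → A
  rdiv : A → A → A
  le_ldiv_iff : ∀ a b c : A, b ≤ ldiv a c ↔ a * b ≤ c
  le_rdiv_iff : ∀ a b c : A, a ≤ rdiv c b ↔ a * b ≤ c

namespace ResiduatedLattice

/-- Direct products, with coordinatewise operations. -/
instance instPi {I : Type*} {B : I → Type*} [∀ i, ResiduatedLattice (B i)] :
    ResiduatedLattice (∀ i, B i) where
  __ := (inferInstance : Lattice (∀ i, B i))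
  __ := (inferInstance : Monoid (∀ i, B i))
  ldiv a c := fun i => ldiv (a i) (c i)
  rdiv c b := fun i => rdiv (c i) (b i)
  le_ldiv_iff a b c :=
    ⟨fun h i => (le_ldiv_iff (a i) (b i) (c i)).1 (h i),
      fun h i => (le_ldiv_iff (a i) (b i) (c i)).2 (h i)⟩
  le_rdiv_iff a b c :=
    ⟨fun h i => (le_rdiv_iff (a i) (b i) (c i)).1 (h i),
      fun h i => (le_rdiv_iff (a i) (b i) (c i)).2 (h i)⟩

/-- Homomorphisms of residuated lattices. -/
structure Hom (A B : Type*) [ResiduatedLattice A] [ResiduatedLattice B] where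
  toFun : A → B
  map_one : toFun 1 = 1
  map_inf : ∀ x y, toFun (x ⊓ y) = toFun x ⊓ toFun y
  map_sup : ∀ x y, toFun (x ⊔ y) = toFun x ⊔ toFun y
  map_mul : ∀ x y, toFun (x * y) = toFun x * toFun y
  map_ldiv : ∀ x y, toFun (ldiv x y) = ldiv (toFun x) (toFun y)
  map_rdiv : ∀ x y, toFun (rdiv x y) = rdiv (toFun x) (toFun y)

/-- Congruences of a residuated lattice. -/
structure Congruence (A : Type*) [ResiduatedLattice A] where
  rel : A → A → Prop
  iseqv : Equivalence rel
  inf : ∀ {x x' y y'}, rel x x' → rel y y' → rel (x ⊓ y) (x' ⊓ y')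
  sup : ∀ {x x' y y'}, rel x x' → rel y y' → rel (x ⊔ y) (x' ⊔ y')
  mul : ∀ {x x' y y'}, rel x x' → rel y y' → rel (x * y) (x' * y')
  ldiv : ∀ {x x' y y'}, rel x x' → rel y y' →
    rel (ResiduatedLattice.ldiv x y) (ResiduatedLattice.ldiv x' y')
  rdiv : ∀ {x x' y y'}, rel x x' → rel y y' →
    rel (ResiduatedLattice.rdiv x y) (ResiduatedLattice.rdiv x' y')

/-- `⟨c, d⟩` belongs to the principal congruence generated by `⟨a, b⟩`, that is, to the
intersection of all congruences containing `⟨a, b⟩`. -/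
def PrincipalCongruence {A : Type*} [ResiduatedLattice A] (a b c d : A) : Prop :=
  ∀ θ : Congruence A, θ.rel a b → θ.rel c d

/-! ### Terms and equations -/

/-- Terms over the variables `X` in the signature of residuated lattices. -/
inductive RLTerm (X : Type) : Type
  | var : X → RLTerm X
  | one : RLTerm X
  | inf : RLTerm X → RLTerm X → RLTerm X
  | sup : RLTerm X → RLTerm X → RLTerm X
  | mul : RLTerm X → RLTerm X → RLTerm X
  | ldiv : RLTerm X → RLTerm X → RLTerm X
  | rdiv : RLTerm X → RLTerm X → RLTerm X

/-- The value of a term under an assignment, i.e. the image of the term under the homomorphism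
from the term algebra extending the assignment. -/
def RLTerm.eval {A : Type*} [ResiduatedLattice A] {X : Type} (v : X → A) : RLTerm X → A
  | .var x => v x
  | .one => 1
  | .inf s t => s.eval v ⊓ t.eval v
  | .sup s t => s.eval v ⊔ t.eval v
  | .mul s t => s.eval v * t.eval v
  | .ldiv s t => ResiduatedLattice.ldiv (s.eval v) (t.eval v)
  | .rdiv s t => ResiduatedLattice.rdiv (s.eval v) (t.eval v)

/-- Equations `s ≈ t` over the variables `X`. -/
abbrev RLEquation (X : Type) : Type := RLTerm X × RLTerm X

/-- The equation holds under the assignment `v`. -/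
def RLEquation.Holds {A : Type*} [ResiduatedLattice A] {X : Type} (v : X → A)
    (ε : RLEquation X) : Prop :=
  ε.1.eval v = ε.2.eval v

/-- A residuated lattice bundled with its universe; classes of residuated lattices are
`Set RLAlg`. -/
structure RLAlg : Type (u + 1) where
  carrier : Type u
  [str : ResiduatedLattice carrier]

instance : CoeSort RLAlg.{u} (Type u) := ⟨RLAlg.carrier⟩

instance (A : RLAlg.{u}) : ResiduatedLattice A := A.str

/-- A variety: the class of all residuated lattices satisfying some set of equations. -/
def IsVariety (V : Set RLAlg.{u}) : Prop :=
  ∃ E : Set (RLEquation ℕ), ∀ A : RLAlg.{u},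
    A ∈ V ↔ ∀ ε ∈ E, ∀ v : ℕ → A, ε.Holds v

/-- `ISP(C)`: the residuated lattices that embed into a direct product of members of `C`
(the empty product is allowed). -/
def ISP (C : Set RLAlg.{u}) : Set RLAlg.{u} :=
  {A | ∃ (I : Type u) (B : I → RLAlg.{u}), (∀ i, B i ∈ C) ∧
    ∃ f : Hom A (∀ i, B i), Function.Injective f.toFun}

/-- Equational consequence `R ⊨_V ε`. -/
def Consequence (V : Set RLAlg.{u}) {X : Type} (R : Set (RLEquation X)) (ε : RLEquation X) :
    Prop :=
  ∀ A : RLAlg.{u}, A ∈ V → ∀ v : X → A, (∀ δ ∈ R, δ.Holds v) → ε.Holds v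

/-- The family `g` generates `A`. -/
def Generates {A : Type*} [ResiduatedLattice A] {X : Type} (g : X → A) : Prop :=
  ∀ a : A, ∃ t : RLTerm X, t.eval g = a

def IsFinitelyGenerated (A : Type*) [ResiduatedLattice A] : Prop :=
  ∃ (n : ℕ) (g : Fin n → A), Generates g

/-- `A` is a finitely presented member of `V`: for some finite set `R` of equations in finitely
many variables, `A` is isomorphic to the quotient of the free algebra of `V` over these variables
by the congruence generated by `R`.  That congruence identifies exactly the terms `s`, `t` with
`R ⊨_V s ≈ t`. -/
def IsFinitelyPresented (V : Set RLAlg.{u}) (A : RLAlg.{u}) : Prop :=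
  A ∈ V ∧ ∃ (n : ℕ) (g : Fin n → A) (R : Set (RLEquation (Fin n))), R.Finite ∧ Generates g ∧
    ∀ ε : RLEquation (Fin n), ε.Holds g ↔ Consequence V R ε

/-- `V` is coherent: every finitely generated subalgebra of a finitely presented member of `V`
is finitely presented (subalgebras are given, up to isomorphism, by embeddings). -/
def IsCoherent (V : Set RLAlg.{u}) : Prop :=
  ∀ B : RLAlg.{u}, IsFinitelyPresented V B →
    ∀ A : RLAlg.{u}, (∃ f : Hom A B, Function.Injective f.toFun) → IsFinitelyGenerated A →
      IsFinitelyPresented V A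

/-- `V` is Hamiltonian: `(e ∧ x)^k y ≈ y (e ∧ x)^k` holds in `V` for some `k ≥ 1`
(for `k = 0` the identity is void). -/
def IsHamiltonian (V : Set RLAlg.{u}) : Prop :=
  ∃ k : ℕ, 1 ≤ k ∧ ∀ A : RLAlg.{u}, A ∈ V →
    ∀ x y : A, (1 ⊓ x) ^ k * y = y * (1 ⊓ x) ^ k

/-- `V` has equationally definable principal congruences: a finite set of equations in four
variables defines, in all members of `V`, membership in principal congruences. -/
def HasEDPC (V : Set RLAlg.{u}) : Prop :=
  ∃ E : Set (RLEquation (Fin 4)), E.Finite ∧ ∀ A : RLAlg.{u}, A ∈ V →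
    ∀ a b c d : A, PrincipalCongruence a b c d ↔ ∀ ε ∈ E, ε.Holds ![a, b, c, d]

/-! ### Canonical extensions -/

section CanonicalExtension

variable {P L : Type u} [PartialOrder P] [CompleteLattice L]

/-- Closed elements: meets of subsets of `P`. -/
def closedElements (e : P ↪o L) : Set L := {c | ∃ X : Set P, c = sInf (e '' X)}

/-- Open elements: joins of subsets of `P`. -/
def openElements (e : P ↪o L) : Set L := {c | ∃ X : Set P, c = sSup (e '' X)}

/-- `⟨e, L⟩` is a canonical extension of the poset `P`: a dense and compact completion. -/
structure IsCanonicalCompletion (e : P ↪o L) : Prop where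
  map_inf : ∀ S : Set P, S.Finite → ∀ a, IsGLB S a → e a = sInf (e '' S)
  map_sup : ∀ S : Set P, S.Finite → ∀ a, IsLUB S a → e a = sSup (e '' S)
  dense_closed : ∀ c : L, ∃ X ⊆ closedElements e, c = sSup X
  dense_open : ∀ c : L, ∃ X ⊆ openElements e, c = sInf X
  compact : ∀ S ⊆ closedElements e, ∀ T ⊆ openElements e,
    (sInf S ≤ sSup T ↔
      ∃ S₀ ⊆ S, ∃ T₀ ⊆ T, S₀.Finite ∧ T₀.Finite ∧ sInf S₀ ≤ sSup T₀)

/-- The extension `f^σ` of a binary operation that is order-preserving in both coordinates: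
`f^σ(p, r) = ⋀ {f(a, b) | p ≤ a, r ≤ b}` for closed `p`, `r`, and
`f^σ(x, y) = ⋁ {f^σ(p, r) | p, r closed, p ≤ x, r ≤ y}`. -/
def sigmaExt (e : P ↪o L) (f : P → P → P) (x y : L) : L :=
  sSup {u | ∃ p ∈ closedElements e, ∃ r ∈ closedElements e, p ≤ x ∧ r ≤ y ∧
    u = sInf {w | ∃ a b : P, p ≤ e a ∧ r ≤ e b ∧ w = e (f a b)}}

/-- The extension `f^π` of a binary operation that is order-reversing in the first and
order-preserving in the second coordinate (so that the open elements of the first coordinate,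
taken in the dual order, are the closed elements of `L`):
`f^π(p, q) = ⋁ {f(a, c) | p ≤ a, c ≤ q}` for `p` closed and `q` open, and
`f^π(x, z) = ⋀ {f^π(p, q) | p closed, q open, p ≤ x, z ≤ q}`. -/
def piExt (e : P ↪o L) (f : P → P → P) (x z : L) : L :=
  sInf {u | ∃ p ∈ closedElements e, ∃ q ∈ openElements e, p ≤ x ∧ z ≤ q ∧
    u = sSup {w | ∃ a c : P, p ≤ e a ∧ e c ≤ q ∧ w = e (f a c)}}

end CanonicalExtension

/-- The residuated lattice `B` is (isomorphic to) the canonical extension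
`⟨A^σ, ∧, ∨, ·^σ, \^π, /^π, e⟩` of `A`.  Here `L` is the complete lattice `A^σ` with embedding
`i : A → A^σ`, and `φ` identifies the lattice `B` with `L`. -/
def IsCanonicalExtension (A B : RLAlg.{u}) : Prop :=
  ∃ (L : Type u) (_ : CompleteLattice L) (φ : B ≃o L) (i : A ↪o L),
    IsCanonicalCompletion i ∧
    φ 1 = i 1 ∧
    (∀ x y : B, φ (x * y) = sigmaExt i (fun a b => a * b) (φ x) (φ y)) ∧
    (∀ x z : B, φ (ldiv x z) = piExt i (fun a c => ldiv a c) (φ x) (φ z)) ∧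
    (∀ z y : B, φ (rdiv z y) = piExt i (fun b c => rdiv c b) (φ y) (φ z))

/-- `C` contains, up to isomorphism, the canonical extension of each of its members. -/
def ClosedUnderCanonicalExtensions (C : Set RLAlg.{u}) : Prop :=
  ∀ A ∈ C, ∃ B ∈ C, IsCanonicalExtension A B

end ResiduatedLattice

namespace ResiduatedLattice

/-! ### Arithmetic of residuated lattices -/

section Arithmetic

variable {A : Type*} [ResiduatedLattice A]

theorem mul_mono {a b c d : A} (hab : a ≤ b) (hcd : c ≤ d) : a * c ≤ b * d := by
  have h₁ : a * c ≤ a * d :=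
    (le_ldiv_iff a c (a * d)).1 (hcd.trans ((le_ldiv_iff a d (a * d)).2 le_rfl))
  have h₂ : a * d ≤ b * d :=
    (le_rdiv_iff a d (b * d)).1 (hab.trans ((le_rdiv_iff b d (b * d)).2 le_rfl))
  exact h₁.trans h₂

theorem mul_ldiv_le (a c : A) : a * ldiv a c ≤ c := (le_ldiv_iff _ _ _).1 le_rfl

theorem rdiv_mul_le (c b : A) : rdiv c b * b ≤ c := (le_rdiv_iff _ _ _).1 le_rfl

theorem ldiv_mono {a b c d : A} (hab : a ≤ b) (hcd : c ≤ d) : ldiv b c ≤ ldiv a d :=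
  (le_ldiv_iff _ _ _).2 (((mul_mono hab le_rfl).trans (mul_ldiv_le b c)).trans hcd)

theorem rdiv_mono {a b c d : A} (hab : a ≤ b) (hcd : c ≤ d) : rdiv c b ≤ rdiv d a :=
  (le_rdiv_iff _ _ _).2 (((mul_mono le_rfl hab).trans (rdiv_mul_le c b)).trans hcd)

theorem one_le_ldiv_self (a : A) : 1 ≤ ldiv a a := (le_ldiv_iff _ _ _).2 (mul_one a).le

theorem sup_mul_le {x y w z : A} (hx : x * w ≤ z) (hy : y * w ≤ z) : (x ⊔ y) * w ≤ z :=
  (le_rdiv_iff _ _ _).1 (sup_le ((le_rdiv_iff _ _ _).2 hx) ((le_rdiv_iff _ _ _).2 hy))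

theorem pow_anti {x : A} (hx : x ≤ 1) : Antitone (fun k : ℕ => x ^ k) :=
  antitone_nat_of_succ_le fun k => by
    simpa [pow_succ] using mul_mono (le_refl (x ^ k)) hx

end Arithmetic

theorem exists_bound_of_finite_subset_range {α : Type*} {s : ℕ → α} {F : Set α} (hF : F.Finite)
    (hs : F ⊆ Set.range s) : ∃ N, ∀ x ∈ F, ∃ k ≤ N, s k = x := by
  have hs' : ∀ x ∈ F, ∃ k, s k = x := fun _ hx => hs hx
  choose! k hk using hs'
  obtain ⟨N, hN⟩ := (hF.image k).bddAbove
  exact ⟨N, fun x hx => ⟨k x, hN ⟨x, hx, rfl⟩, hk x hx⟩⟩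

/-! ### Homomorphisms and substitution -/

theorem Hom.map_eval {A B : Type*} [ResiduatedLattice A] [ResiduatedLattice B] (f : Hom A B)
    {X : Type} (v : X → A) (t : RLTerm X) :
    f.toFun (t.eval v) = t.eval (fun x => f.toFun (v x)) := by
  induction t with
  | var x => rfl
  | one => exact f.map_one
  | inf s t hs ht => simp only [RLTerm.eval, f.map_inf, hs, ht]
  | sup s t hs ht => simp only [RLTerm.eval, f.map_sup, hs, ht]
  | mul s t hs ht => simp only [RLTerm.eval, f.map_mul, hs, ht]
  | ldiv s t hs ht => simp only [RLTerm.eval, f.map_ldiv, hs, ht]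
  | rdiv s t hs ht => simp only [RLTerm.eval, f.map_rdiv, hs, ht]

theorem Hom.map_pow {A B : Type*} [ResiduatedLattice A] [ResiduatedLattice B] (f : Hom A B)
    (a : A) (k : ℕ) : f.toFun (a ^ k) = f.toFun a ^ k := by
  induction k with
  | zero => simp [f.map_one]
  | succ k ih => rw [pow_succ, pow_succ, f.map_mul, ih]

theorem Hom.mono {A B : Type*} [ResiduatedLattice A] [ResiduatedLattice B] (f : Hom A B)
    {a b : A} (h : a ≤ b) : f.toFun a ≤ f.toFun b := by
  rw [← inf_eq_left, ← f.map_inf, inf_eq_left.2 h]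

/-- Composition of homomorphisms. -/
def Hom.comp {A B D : Type*} [ResiduatedLattice A] [ResiduatedLattice B] [ResiduatedLattice D]
    (g : Hom B D) (f : Hom A B) : Hom A D where
  toFun a := g.toFun (f.toFun a)
  map_one := by rw [f.map_one, g.map_one]
  map_inf x y := by rw [f.map_inf, g.map_inf]
  map_sup x y := by rw [f.map_sup, g.map_sup]
  map_mul x y := by rw [f.map_mul, g.map_mul]
  map_ldiv x y := by rw [f.map_ldiv, g.map_ldiv]
  map_rdiv x y := by rw [f.map_rdiv, g.map_rdiv]

/-- The product of a family of homomorphisms. -/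
def Hom.piMap {I : Type*} {B D : I → Type*} [∀ i, ResiduatedLattice (B i)]
    [∀ i, ResiduatedLattice (D i)] (f : ∀ i, Hom (B i) (D i)) :
    Hom (∀ i, B i) (∀ i, D i) where
  toFun b i := (f i).toFun (b i)
  map_one := funext fun i => (f i).map_one
  map_inf _ _ := funext fun i => (f i).map_inf _ _
  map_sup _ _ := funext fun i => (f i).map_sup _ _
  map_mul _ _ := funext fun i => (f i).map_mul _ _
  map_ldiv _ _ := funext fun i => (f i).map_ldiv _ _
  map_rdiv _ _ := funext fun i => (f i).map_rdiv _ _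

/-- The identity homomorphism. -/
def Hom.id (A : Type*) [ResiduatedLattice A] : Hom A A where
  toFun a := a
  map_one := rfl
  map_inf _ _ := rfl
  map_sup _ _ := rfl
  map_mul _ _ := rfl
  map_ldiv _ _ := rfl
  map_rdiv _ _ := rfl

/-- Substitution of terms for variables. -/
def RLTerm.subst {X Y : Type} (σ : X → RLTerm Y) : RLTerm X → RLTerm Y
  | .var x => σ x
  | .one => .one
  | .inf s t => .inf (s.subst σ) (t.subst σ)
  | .sup s t => .sup (s.subst σ) (t.subst σ)
  | .mul s t => .mul (s.subst σ) (t.subst σ)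
  | .ldiv s t => .ldiv (s.subst σ) (t.subst σ)
  | .rdiv s t => .rdiv (s.subst σ) (t.subst σ)

theorem RLTerm.eval_subst {A : Type*} [ResiduatedLattice A] {X Y : Type} (σ : X → RLTerm Y)
    (v : Y → A) (t : RLTerm X) : (t.subst σ).eval v = t.eval (fun x => (σ x).eval v) := by
  induction t <;> simp_all [RLTerm.subst, RLTerm.eval]

/-- Powers of terms. -/
def RLTerm.pow {X : Type} (t : RLTerm X) : ℕ → RLTerm X
  | 0 => .one
  | k + 1 => .mul (t.pow k) t

theorem RLTerm.eval_pow {A : Type*} [ResiduatedLattice A] {X : Type} (v : X → A) (t : RLTerm X)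
    (k : ℕ) : (t.pow k).eval v = t.eval v ^ k := by
  induction k with
  | zero => simp [RLTerm.pow, RLTerm.eval]
  | succ k ih => simp [RLTerm.pow, RLTerm.eval, ih, pow_succ]

/-- The equation expressing `s ≤ t`. -/
def leEquation {X : Type} (s t : RLTerm X) : RLEquation X := (.inf s t, s)

theorem holds_leEquation {A : Type*} [ResiduatedLattice A] {X : Type} (v : X → A)
    (s t : RLTerm X) : (leEquation s t).Holds v ↔ s.eval v ≤ t.eval v := inf_eq_left

/-! ### Algebras presented by generators and relations, and compactness of consequence -/

section Presentation

variable {V : Set RLAlg.{u}} {X : Type}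

/-- Consequence from a finite subset of the hypotheses. -/
def FinConsequence (V : Set RLAlg.{u}) (R : Set (RLEquation X)) (ε : RLEquation X) : Prop :=
  ∃ R₀ ⊆ R, R₀.Finite ∧ Consequence V R₀ ε

theorem FinConsequence.exists_finite {R H : Set (RLEquation X)} (hH : H.Finite)
    (h : ∀ δ ∈ H, FinConsequence V R δ) :
    ∃ R₀ ⊆ R, R₀.Finite ∧ ∀ δ ∈ H, Consequence V R₀ δ := by
  choose! F hF using h
  refine ⟨⋃ δ ∈ H, F δ, Set.iUnion₂_subset fun δ hδ => (hF δ hδ).1,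
    hH.biUnion fun δ hδ => (hF δ hδ).2.1, fun δ hδ A hA v hv => (hF δ hδ).2.2 A hA v ?_⟩
  exact fun γ hγ => hv γ (Set.mem_biUnion hδ hγ)

theorem FinConsequence.trans {R H : Set (RLEquation X)} {ε : RLEquation X} (hH : H.Finite)
    (h : ∀ δ ∈ H, FinConsequence V R δ) (hε : Consequence V H ε) : FinConsequence V R ε := by
  obtain ⟨R₀, hR₀, hfin, hc⟩ := exists_finite hH h
  exact ⟨R₀, hR₀, hfin, fun A hA v hv => hε A hA v fun δ hδ => hc δ hδ A hA v hv⟩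

theorem FinConsequence.of_valid {R : Set (RLEquation X)} {ε : RLEquation X}
    (h : ∀ A ∈ V, ∀ v : X → A, ε.Holds v) : FinConsequence V R ε :=
  ⟨∅, Set.empty_subset _, Set.finite_empty, fun A hA v _ => h A hA v⟩

theorem FinConsequence.imp {R : Set (RLEquation X)} {δ ε : RLEquation X}
    (hδ : FinConsequence V R δ) (h : ∀ A ∈ V, ∀ v : X → A, δ.Holds v → ε.Holds v) :
    FinConsequence V R ε :=
  trans (Set.finite_singleton δ) (by simpa using hδ)
    fun A hA v hv => h A hA v (hv δ rfl)

theorem FinConsequence.imp₂ {R : Set (RLEquation X)} {γ δ ε : RLEquation X}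
    (hγ : FinConsequence V R γ) (hδ : FinConsequence V R δ)
    (h : ∀ A ∈ V, ∀ v : X → A, γ.Holds v → δ.Holds v → ε.Holds v) :
    FinConsequence V R ε :=
  trans (H := {γ, δ}) (by simp) (by simpa using ⟨hγ, hδ⟩)
    fun A hA v hv => h A hA v (hv γ (by simp)) (hv δ (by simp))

/-- Terms up to consequence from `R` in `V`. -/
def presentedSetoid (V : Set RLAlg.{u}) (R : Set (RLEquation X)) :
    Setoid (ULift.{u} (RLTerm X)) where
  r s t := FinConsequence V R (s.down, t.down)
  iseqv :=
    { refl := fun _ => .of_valid fun _ _ _ => rfl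
      symm := fun h => h.imp fun _ _ _ e => Eq.symm e
      trans := fun h h' => h.imp₂ h' fun _ _ _ e e' => Eq.trans e e' }

/-- The universe of the algebra of `V` presented by the relations `R`. -/
def Presented (V : Set RLAlg.{u}) (R : Set (RLEquation X)) : Type u :=
  Quotient (presentedSetoid V R)

namespace Presented

variable (V) (R : Set (RLEquation X))

/-- The class of a term. -/
def mk (t : RLTerm X) : Presented V R := Quotient.mk (presentedSetoid V R) ⟨t⟩

variable {V R}

theorem mk_eq_iff {s t : RLTerm X} : mk V R s = mk V R t ↔ FinConsequence V R (s, t) :=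
  Quotient.eq (r := presentedSetoid V R)

theorem ind {p : Presented V R → Prop} (h : ∀ t, p (mk V R t)) (a : Presented V R) : p a :=
  Quotient.inductionOn a fun t => h t.down

/-- The operation on classes induced by a binary operation on terms compatible with
consequence. -/
def map₂ (op : RLTerm X → RLTerm X → RLTerm X)
    (h : ∀ s s' t t' : RLTerm X, ∀ A ∈ V, ∀ v : X → A, s.eval v = s'.eval v →
      t.eval v = t'.eval v → (op s t).eval v = (op s' t').eval v) :
    Presented V R → Presented V R → Presented V R :=
  Quotient.map₂ (fun s t => ⟨op s.down t.down⟩) fun _ _ hs _ _ ht =>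
    FinConsequence.imp₂ hs ht fun A hA v => h _ _ _ _ A hA v

instance : Min (Presented V R) :=
  ⟨map₂ .inf fun _ _ _ _ _ _ _ hs ht => congrArg₂ (· ⊓ ·) hs ht⟩

instance : Max (Presented V R) :=
  ⟨map₂ .sup fun _ _ _ _ _ _ _ hs ht => congrArg₂ (· ⊔ ·) hs ht⟩

instance : Mul (Presented V R) :=
  ⟨map₂ .mul fun _ _ _ _ _ _ _ hs ht => congrArg₂ (· * ·) hs ht⟩

instance : One (Presented V R) := ⟨mk V R .one⟩

theorem mk_eq_of_valid {s t : RLTerm X}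
    (h : ∀ A ∈ V, ∀ v : X → A, s.eval v = t.eval v) : mk V R s = mk V R t :=
  mk_eq_iff.2 (.of_valid h)

instance : Lattice (Presented V R) :=
  Lattice.mk'
    (ind fun _ => ind fun _ => mk_eq_of_valid fun _ _ _ => sup_comm _ _)
    (ind fun _ => ind fun _ => ind fun _ => mk_eq_of_valid fun _ _ _ => sup_assoc _ _ _)
    (ind fun _ => ind fun _ => mk_eq_of_valid fun _ _ _ => inf_comm _ _)
    (ind fun _ => ind fun _ => ind fun _ => mk_eq_of_valid fun _ _ _ => inf_assoc _ _ _)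
    (ind fun _ => ind fun _ => mk_eq_of_valid fun _ _ _ => sup_inf_self)
    (ind fun _ => ind fun _ => mk_eq_of_valid fun _ _ _ => inf_sup_self)

instance : Monoid (Presented V R) where
  mul_assoc := ind fun _ => ind fun _ => ind fun _ => mk_eq_of_valid fun _ _ _ => mul_assoc _ _ _
  one_mul := ind fun _ => mk_eq_of_valid fun _ _ _ => one_mul _
  mul_one := ind fun _ => mk_eq_of_valid fun _ _ _ => mul_one _

theorem mk_le_mk_iff {s t : RLTerm X} :
    mk V R s ≤ mk V R t ↔ FinConsequence V R (leEquation s t) := by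
  rw [← inf_eq_left, ← mk_eq_iff]
  rfl

theorem mk_le_mk_congr {s t s' t' : RLTerm X}
    (h : ∀ A ∈ V, ∀ v : X → A, s.eval v ≤ t.eval v ↔ s'.eval v ≤ t'.eval v) :
    mk V R s ≤ mk V R t ↔ mk V R s' ≤ mk V R t' := by
  rw [mk_le_mk_iff, mk_le_mk_iff]
  constructor <;> refine fun hc => hc.imp fun A hA v hv => ?_
  · exact (holds_leEquation _ _ _).2 ((h A hA v).1 ((holds_leEquation _ _ _).1 hv))
  · exact (holds_leEquation _ _ _).2 ((h A hA v).2 ((holds_leEquation _ _ _).1 hv))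

instance : ResiduatedLattice (Presented V R) where
  ldiv := map₂ .ldiv fun _ _ _ _ _ _ _ hs ht => congrArg₂ ResiduatedLattice.ldiv hs ht
  rdiv := map₂ .rdiv fun _ _ _ _ _ _ _ hs ht => congrArg₂ ResiduatedLattice.rdiv hs ht
  le_ldiv_iff := ind fun _ => ind fun _ => ind fun _ =>
    mk_le_mk_congr fun _ _ _ => ResiduatedLattice.le_ldiv_iff _ _ _
  le_rdiv_iff := ind fun _ => ind fun _ => ind fun _ =>
    mk_le_mk_congr fun _ _ _ => ResiduatedLattice.le_rdiv_iff _ _ _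

theorem eval_mk {Y : Type} (σ : Y → RLTerm X) (t : RLTerm Y) :
    t.eval (fun y => mk V R (σ y)) = mk V R (t.subst σ) := by
  induction t with
  | var x => rfl
  | one => rfl
  | inf s t hs ht => simp only [RLTerm.eval, hs, ht]; rfl
  | sup s t hs ht => simp only [RLTerm.eval, hs, ht]; rfl
  | mul s t hs ht => simp only [RLTerm.eval, hs, ht]; rfl
  | ldiv s t hs ht => simp only [RLTerm.eval, hs, ht]; rfl
  | rdiv s t hs ht => simp only [RLTerm.eval, hs, ht]; rfl

theorem subst_var (t : RLTerm X) : t.subst RLTerm.var = t := by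
  induction t <;> simp_all [RLTerm.subst]

/-- The generators of a presented algebra. -/
def gen (V : Set RLAlg.{u}) (R : Set (RLEquation X)) (x : X) : Presented V R := mk V R (.var x)

theorem eval_gen (t : RLTerm X) : t.eval (gen V R) = mk V R t := by
  have h := eval_mk (V := V) (R := R) RLTerm.var t
  rwa [subst_var] at h

theorem generates_gen : Generates (gen V R) :=
  ind fun t => ⟨t, eval_gen t⟩

theorem holds_gen_iff {ε : RLEquation X} : ε.Holds (gen V R) ↔ FinConsequence V R ε := by
  unfold RLEquation.Holds
  rw [eval_gen, eval_gen, mk_eq_iff]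

variable (V R) in
/-- The algebra of `V` presented by the relations `R`. -/
def alg : RLAlg.{u} := ⟨Presented V R⟩

theorem alg_mem (hV : IsVariety V) : alg V R ∈ V := by
  obtain ⟨E, hE⟩ := hV
  refine (hE _).2 fun ε hε v => ?_
  have hσ : ∀ x, ∃ t, mk V R t = v x := fun x => ind (p := fun a => ∃ t, mk V R t = a)
    (fun t => ⟨t, rfl⟩) (v x)
  choose σ hσ using hσ
  obtain rfl : (fun x => mk V R (σ x)) = v := funext hσ
  refine (eval_mk σ ε.1).trans (Eq.trans (mk_eq_of_valid fun A hA w => ?_) (eval_mk σ ε.2).symm)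
  rw [RLTerm.eval_subst, RLTerm.eval_subst]
  exact (hE A).1 hA ε hε _

end Presented

/-- Equational consequence in a variety is compact. -/
theorem Consequence.finConsequence (hV : IsVariety V) {R : Set (RLEquation X)}
    {ε : RLEquation X} (h : Consequence V R ε) : FinConsequence V R ε :=
  Presented.holds_gen_iff.1 (h (Presented.alg V R) (Presented.alg_mem hV) (Presented.gen V R)
    fun δ hδ => Presented.holds_gen_iff.2
      ⟨{δ}, by simpa using hδ, Set.finite_singleton δ, fun _ _ _ hv => hv δ rfl⟩)

theorem consequence_iff_finConsequence (hV : IsVariety V) {R : Set (RLEquation X)}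
    {ε : RLEquation X} : Consequence V R ε ↔ FinConsequence V R ε :=
  ⟨fun h => h.finConsequence hV, fun ⟨_, hR₀, _, h⟩ A hA v hv => h A hA v fun δ hδ =>
    hv δ (hR₀ hδ)⟩

theorem Presented.holds_gen_iff_consequence (hV : IsVariety V) {R : Set (RLEquation X)}
    {ε : RLEquation X} : ε.Holds (Presented.gen V R) ↔ Consequence V R ε :=
  Presented.holds_gen_iff.trans (consequence_iff_finConsequence hV).symm

theorem Presented.isFinitelyPresented (hV : IsVariety V) {n : ℕ}
    {R : Set (RLEquation (Fin n))} (hR : R.Finite) :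
    IsFinitelyPresented V (Presented.alg V R) :=
  ⟨alg_mem hV, n, gen V R, R, hR, generates_gen, fun _ => holds_gen_iff_consequence hV⟩

/-- A translation of terms that preserves and reflects consequence embeds the presented
algebras. -/
theorem Presented.exists_embedding {Y : Type} {R : Set (RLEquation X)} {S : Set (RLEquation Y)}
    (hV : IsVariety V) (σ : X → RLTerm Y)
    (h : ∀ ε : RLEquation X, Consequence V R ε ↔
      Consequence V S (ε.1.subst σ, ε.2.subst σ)) :
    ∃ f : Hom (Presented.alg V R) (Presented.alg V S), Function.Injective f.toFun := by
  have h' : ∀ s t : RLTerm X, mk V R s = mk V R t ↔ mk V S (s.subst σ) = mk V S (t.subst σ) := by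
    intro s t
    rw [mk_eq_iff, mk_eq_iff, ← consequence_iff_finConsequence hV, h,
      consequence_iff_finConsequence hV]
  let F : Presented V R → Presented V S := Quotient.lift
    (fun t : ULift.{u} (RLTerm X) => mk V S (t.down.subst σ))
    fun s t hst => (h' s.down t.down).1 (mk_eq_iff.2 hst)
  refine ⟨⟨F, rfl, ind fun s => ind fun t => rfl, ind fun s => ind fun t => rfl,
    ind fun s => ind fun t => rfl, ind fun s => ind fun t => rfl,
    ind fun s => ind fun t => rfl⟩, ?_⟩
  exact fun a => ind (p := fun a => ∀ b, F a = F b → a = b)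
    (fun s => ind fun t hst => (h' s t).2 hst) a

/-- Finite presentability does not depend on the generators: a finitely presented algebra given
by a presentation with finitely many generators needs only finitely many of its relations. -/
theorem exists_finite_of_isFinitelyPresented (hV : IsVariety V) [Finite X]
    {R : Set (RLEquation X)} (h : IsFinitelyPresented V (Presented.alg V R)) :
    ∃ R₀ ⊆ R, R₀.Finite ∧ ∀ ε, Consequence V R ε → Consequence V R₀ ε := by
  obtain ⟨-, n, g, S, hS, hg, hgS⟩ := h
  choose σ hσ using fun j => Presented.generates_gen (V := V) (R := R) (g j)
  choose τ hτ using fun x => hg (Presented.gen V R x)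
  let Δ : Set (RLEquation X) :=
    (fun ε : RLEquation (Fin n) => (ε.1.subst σ, ε.2.subst σ)) '' S ∪
      Set.range fun x => ((τ x).subst σ, RLTerm.var x)
  have hΔ : Δ.Finite := (hS.image _).union (Set.finite_range _)
  obtain rfl : (fun j => (σ j).eval (Presented.gen V R)) = g := funext hσ
  have hΔR : ∀ δ ∈ Δ, FinConsequence V R δ := by
    intro δ hδ
    rw [← Presented.holds_gen_iff]
    rcases hδ with ⟨ε, hε, rfl⟩ | ⟨x, rfl⟩
    · have : ε.Holds (A := Presented.alg V R) (fun j => (σ j).eval (Presented.gen V R)) :=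
        (hgS ε).2 fun A hA v hv => hv ε hε
      exact ((RLTerm.eval_subst _ _ _).trans this).trans (RLTerm.eval_subst _ _ _).symm
    · exact (RLTerm.eval_subst _ _ _).trans (hτ x)
  obtain ⟨R₀, hR₀, hfin, hc⟩ := FinConsequence.exists_finite hΔ hΔR
  refine ⟨R₀, hR₀, hfin, fun ε hε D hD v hv => ?_⟩
  have hv' : (fun x => (τ x).eval fun j => (σ j).eval v) = v := by
    funext x
    have := hc _ (Or.inr ⟨x, rfl⟩) D hD v hv
    exact (RLTerm.eval_subst _ _ _).symm.trans this
  have hετ : Consequence V S (ε.1.subst τ, ε.2.subst τ) := by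
    rw [← hgS]
    have h₁ := (Presented.holds_gen_iff_consequence hV).2 hε
    have hτ' : (fun x => (τ x).eval fun j => (σ j).eval (Presented.gen V R)) =
      Presented.gen V R := funext hτ
    refine (RLTerm.eval_subst _ _ _).trans (Eq.trans ?_ (RLTerm.eval_subst _ _ _).symm)
    exact (congrArg ε.1.eval hτ').trans (h₁.trans (congrArg ε.2.eval hτ').symm)
  have h₂ := hετ D hD (fun j => (σ j).eval v) fun δ hδ => by
    have := hc _ (Or.inl ⟨δ, hδ, rfl⟩) D hD v hv
    exact (RLTerm.eval_subst _ _ _).symm.trans (Eq.trans this (RLTerm.eval_subst _ _ _))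
  rw [RLEquation.Holds, RLTerm.eval_subst, RLTerm.eval_subst, hv'] at h₂
  exact h₂

end Presentation

/-! ### Canonical extensions -/

section CanonicalExtension

variable {P L : Type u} [PartialOrder P] [CompleteLattice L]

theorem mem_closedElements (e : P ↪o L) (a : P) : e a ∈ closedElements e := ⟨{a}, by simp⟩

theorem mem_openElements (e : P ↪o L) (a : P) : e a ∈ openElements e := ⟨{a}, by simp⟩

theorem sigmaExt_embedding (e : P ↪o L) {f : P → P → P}
    (hf : ∀ a b c d, a ≤ b → c ≤ d → f a c ≤ f b d) (a b : P) :
    sigmaExt e f (e a) (e b) = e (f a b) := by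
  refine le_antisymm (sSup_le ?_) (le_sSup ?_)
  · rintro _ ⟨p, -, r, -, hp, hr, rfl⟩
    exact sInf_le ⟨a, b, hp, hr, rfl⟩
  · refine ⟨e a, mem_closedElements e a, e b, mem_closedElements e b, le_rfl, le_rfl,
      le_antisymm (le_sInf ?_) (sInf_le ⟨a, b, le_rfl, le_rfl, rfl⟩)⟩
    rintro _ ⟨a', b', ha, hb, rfl⟩
    exact e.monotone (hf _ _ _ _ (e.le_iff_le.1 ha) (e.le_iff_le.1 hb))

theorem piExt_embedding (e : P ↪o L) {f : P → P → P}
    (hf : ∀ a b c d, a ≤ b → c ≤ d → f b c ≤ f a d) (a c : P) :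
    piExt e f (e a) (e c) = e (f a c) := by
  refine le_antisymm (sInf_le ?_) (le_sInf ?_)
  · refine ⟨e a, mem_closedElements e a, e c, mem_openElements e c, le_rfl, le_rfl,
      le_antisymm (le_sSup ⟨a, c, le_rfl, le_rfl, rfl⟩) (sSup_le ?_)⟩
    rintro _ ⟨a', c', ha, hc, rfl⟩
    exact e.monotone (hf _ _ _ _ (e.le_iff_le.1 ha) (e.le_iff_le.1 hc))
  · rintro _ ⟨p, -, q, -, hp, hq, rfl⟩
    exact le_sSup ⟨a, c, hp, hq, rfl⟩

/-- By compactness, an element of `P` above the meet of a decreasing sequence of elements of `P`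
is above a member of the sequence. -/
theorem IsCanonicalCompletion.exists_le_of_iInf_le {e : P ↪o L} (he : IsCanonicalCompletion e)
    {s : ℕ → P} (hs : Antitone s) {a : P} (h : ⨅ k, e (s k) ≤ e a) : ∃ k, s k ≤ a := by
  have hS : Set.range (fun k => e (s k)) ⊆ closedElements e := by
    rintro _ ⟨k, rfl⟩
    exact mem_closedElements e _
  have hT : {e a} ⊆ openElements e := by
    rintro _ rfl
    exact mem_openElements e a
  obtain ⟨S₀, hS₀, T₀, hT₀, hfin, -, hle⟩ := (he.compact _ hS _ hT).1 (by simpa [sInf_range] using h)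
  have hle' : sInf S₀ ≤ e a := hle.trans (sSup_le fun t ht => (hT₀ ht).le)
  obtain ⟨N, hN⟩ := exists_bound_of_finite_subset_range hfin hS₀
  refine ⟨N, e.le_iff_le.1 (le_trans (le_sInf fun x hx => ?_) hle')⟩
  obtain ⟨k, hk, rfl⟩ := hN x hx
  exact e.monotone (hs hk)

theorem iInf_pow_le_sigmaExt {A : Type u} [ResiduatedLattice A] {e : A ↪o L}
    (he : IsCanonicalCompletion e) {u : A} (hu : u ≤ 1) :
    ⨅ k : ℕ, e (u ^ k) ≤ sigmaExt e (fun a b => a * b) (⨅ k : ℕ, e (u ^ k)) (e u) := by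
  have hp : ⨅ k : ℕ, e (u ^ k) ∈ closedElements e :=
    ⟨Set.range fun k : ℕ => u ^ k, by rw [← Set.range_comp, sInf_range]; rfl⟩
  refine le_trans (le_sInf ?_)
    (le_sSup ⟨_, hp, _, mem_closedElements e u, le_rfl, le_rfl, rfl⟩)
  rintro _ ⟨a, b, ha, hb, rfl⟩
  obtain ⟨k, hk⟩ := he.exists_le_of_iInf_le (pow_anti hu) ha
  refine (iInf_le _ (k + 1)).trans (e.monotone ?_)
  rw [pow_succ]
  exact mul_mono hk (e.le_iff_le.1 hb)

/-- A residuated lattice embeds into its canonical extension, where the powers of an element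
below `e` have a greatest lower bound, which is a fixpoint of multiplication by this element. -/
theorem IsCanonicalExtension.exists_embedding {A B : RLAlg.{u}} (h : IsCanonicalExtension A B) :
    ∃ f : Hom A B, Function.Injective f.toFun ∧ ∀ u : A, u ≤ 1 → ∃ x : B,
      IsGLB (Set.range fun k : ℕ => f.toFun u ^ k) x ∧ x ≤ x * f.toFun u := by
  obtain ⟨L, _, φ, i, hi, h1, hmul, hl, hr⟩ := h
  let f : Hom A B :=
    { toFun := fun a => φ.symm (i a)
      map_one := by rw [← h1, φ.symm_apply_apply]
      map_inf := fun a b => by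
        rw [← map_inf, hi.map_inf {a, b} (by simp) (a ⊓ b) isGLB_pair, Set.image_pair, sInf_pair]
      map_sup := fun a b => by
        rw [← map_sup, hi.map_sup {a, b} (by simp) (a ⊔ b) isLUB_pair, Set.image_pair, sSup_pair]
      map_mul := fun a b => by
        apply φ.injective
        rw [hmul]
        simp only [φ.apply_symm_apply]
        rw [sigmaExt_embedding i fun _ _ _ _ => mul_mono]
      map_ldiv := fun a b => by
        apply φ.injective
        rw [hl]
        simp only [φ.apply_symm_apply]
        rw [piExt_embedding i fun _ _ _ _ => ldiv_mono]
      map_rdiv := fun a b => by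
        apply φ.injective
        rw [hr]
        simp only [φ.apply_symm_apply]
        rw [piExt_embedding i fun _ _ _ _ => rdiv_mono] }
  refine ⟨f, fun a b hab => i.injective (φ.symm.injective hab), fun u hu =>
    ⟨φ.symm (⨅ k : ℕ, i (u ^ k)), ?_, ?_⟩⟩
  · simp only [← f.map_pow]
    constructor
    · rintro _ ⟨k, rfl⟩
      exact φ.symm.monotone (iInf_le _ k)
    · intro y hy
      rw [φ.le_symm_apply]
      exact le_iInf fun k => (φ.le_symm_apply).1 (hy ⟨k, rfl⟩)
  · rw [← φ.le_iff_le, hmul]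
    simpa [f] using iInf_pow_le_sigmaExt hi hu

end CanonicalExtension

/-- If `C` is closed under canonical extensions, then every member of `ISP C` embeds into
a member in which the powers of a given element below `e` have a greatest lower bound, which is
a fixpoint of multiplication by this element. -/
theorem ClosedUnderCanonicalExtensions.exists_embedding {C : Set RLAlg.{u}}
    (hC : ClosedUnderCanonicalExtensions C) {D : RLAlg.{u}} (hD : D ∈ ISP C) {u : D}
    (hu : u ≤ 1) :
    ∃ E ∈ ISP C, ∃ f : Hom D E, Function.Injective f.toFun ∧ ∃ x : E,
      IsGLB (Set.range fun k : ℕ => f.toFun u ^ k) x ∧ x ≤ x * f.toFun u := by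
  obtain ⟨I, B, hB, g, hg⟩ := hD
  choose B' hB' hBB' using fun i => hC (B i) (hB i)
  choose j hj hx using fun i => (hBB' i).exists_embedding
  have hgu : ∀ i, g.toFun u i ≤ 1 := by
    have := g.mono hu
    rw [g.map_one] at this
    exact this
  choose x hx hxu using fun i => hx i _ (hgu i)
  refine ⟨⟨∀ i, B' i⟩, ⟨I, B', hB', Hom.id _, fun _ _ h => h⟩, (Hom.piMap j).comp g,
    fun a b hab => hg (funext fun i => hj i (congrFun hab i)), x, ?_, fun i => hxu i⟩
  constructor
  · rintro _ ⟨k, rfl⟩ i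
    exact (hx i).1 ⟨k, rfl⟩
  · intro y hy i
    refine (hx i).2 ?_
    rintro _ ⟨k, rfl⟩
    exact hy ⟨k, rfl⟩ i

/-! ### Coherence bounds the powers of negative elements -/

/-- The relations `0 ≤ (e ∧ 1)^k` in the variables `0` and `1`. -/
def powRelations : Set (RLEquation (Fin 2)) :=
  Set.range fun k : ℕ => leEquation (.var 0) ((RLTerm.inf .one (.var 1)).pow k)

/-- The relations `0 ≤ 2 ≤ e` and `2 ≤ 2 (e ∧ 1)` in the variables `0`, `1` and `2`. -/
def fixpointRelations : Set (RLEquation (Fin 3)) :=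
  {leEquation (.var 0) (.var 2), leEquation (.var 2) .one,
    leEquation (.var 2) (.mul (.var 2) (.inf .one (.var 1)))}

theorem holds_powRelations {A : Type*} [ResiduatedLattice A] (v : Fin 2 → A) :
    (∀ δ ∈ powRelations, δ.Holds v) ↔ ∀ k : ℕ, v 0 ≤ (1 ⊓ v 1) ^ k := by
  simp only [powRelations, Set.forall_mem_range, holds_leEquation, RLTerm.eval_pow, RLTerm.eval]

theorem holds_fixpointRelations {A : Type*} [ResiduatedLattice A] (v : Fin 3 → A) :
    (∀ δ ∈ fixpointRelations, δ.Holds v) ↔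
      v 0 ≤ v 2 ∧ v 2 ≤ 1 ∧ v 2 ≤ v 2 * (1 ⊓ v 1) := by
  simp only [fixpointRelations, Set.mem_insert_iff, Set.mem_singleton_iff, forall_eq_or_imp,
    forall_eq, holds_leEquation, RLTerm.eval]

/-- The inclusion of the variables `0` and `1`. -/
def inclusion : Fin 2 → RLTerm (Fin 3) := fun j => .var j.castSucc

/-- Eliminating the fixpoint from `fixpointRelations` leaves exactly `powRelations`. -/
theorem consequence_powRelations_iff {C : Set RLAlg.{u}} (hC : ClosedUnderCanonicalExtensions C)
    (ε : RLEquation (Fin 2)) :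
    Consequence (ISP C) powRelations ε ↔
      Consequence (ISP C) fixpointRelations (ε.1.subst inclusion, ε.2.subst inclusion) := by
  constructor
  · intro h A hA v hv
    rw [RLEquation.Holds, RLTerm.eval_subst, RLTerm.eval_subst]
    refine h A hA _ ((holds_powRelations _).2 fun k => ?_)
    obtain ⟨h₀, h₁, h₂⟩ := (holds_fixpointRelations v).1 hv
    have h₃ : ∀ k : ℕ, v 2 ≤ v 2 * (1 ⊓ v 1) ^ k := by
      intro k
      induction k with
      | zero => simp
      | succ k ih =>
        rw [pow_succ', ← mul_assoc]
        exact ih.trans (mul_mono h₂ le_rfl)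
    have h₄ : v 2 ≤ (1 ⊓ v 1) ^ k := by
      simpa using (h₃ k).trans (mul_mono h₁ le_rfl)
    exact h₀.trans h₄
  · intro h D hD v hv
    rw [holds_powRelations] at hv
    obtain ⟨E, hE, f, hf, x, hx, hxu⟩ :=
      hC.exists_embedding hD (u := 1 ⊓ v 1) inf_le_left
    rw [f.map_inf, f.map_one] at hxu
    have hc := h E hE ![f.toFun (v 0), f.toFun (v 1), x] ((holds_fixpointRelations _).2
      ⟨hx.2 ?_, by simpa using hx.1 ⟨0, rfl⟩, hxu⟩)
    · rw [RLEquation.Holds, RLTerm.eval_subst, RLTerm.eval_subst] at hc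
      have hv' : (fun j => (inclusion j).eval ![f.toFun (v 0), f.toFun (v 1), x]) =
          fun j => f.toFun (v j) := by
        funext j
        fin_cases j <;> rfl
      rw [hv', ← f.map_eval, ← f.map_eval] at hc
      exact hf hc
    · rintro _ ⟨k, rfl⟩
      change _ ≤ f.toFun (1 ⊓ v 1) ^ k
      rw [← f.map_pow]
      exact f.mono (hv k)

theorem exists_pow_succ_eq_pow {C : Set RLAlg.{u}} (hV : IsVariety (ISP C))
    (hC : ClosedUnderCanonicalExtensions C) (hCoh : IsCoherent (ISP C)) :
    ∃ n : ℕ, ∀ A : RLAlg.{u}, A ∈ ISP C → ∀ x : A, (1 ⊓ x) ^ (n + 1) = (1 ⊓ x) ^ n := by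
  have hfp : IsFinitelyPresented (ISP C) (Presented.alg (ISP C) powRelations) :=
    hCoh _ (Presented.isFinitelyPresented hV (R := fixpointRelations)
        (by simp [fixpointRelations])) _
      (Presented.exists_embedding hV inclusion (consequence_powRelations_iff hC))
      ⟨2, Presented.gen _ _, Presented.generates_gen⟩
  obtain ⟨R₀, hR₀, hfin, hc⟩ := exists_finite_of_isFinitelyPresented hV hfp
  obtain ⟨N, hN⟩ := exists_bound_of_finite_subset_range hfin hR₀
  refine ⟨N, fun A hA x => le_antisymm (pow_anti inf_le_left N.le_succ) ?_⟩
  have h := hc (leEquation (.var 0) ((RLTerm.inf .one (.var 1)).pow (N + 1)))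
    (fun D hD v hv => hv _ ⟨N + 1, rfl⟩) A hA ![(1 ⊓ x) ^ N, x] fun δ hδ => by
      obtain ⟨k, hk, rfl⟩ := hN δ hδ
      rw [holds_leEquation, RLTerm.eval_pow]
      exact pow_anti inf_le_left hk
  rwa [holds_leEquation, RLTerm.eval_pow] at h

/-! ### Equationally definable principal congruences -/

/-- The congruence determined by a central idempotent element below `e`. -/
def Congruence.ofCentral {A : Type*} [ResiduatedLattice A] (w : A) (hw : w ≤ 1)
    (hidem : w * w = w) (hcomm : ∀ y, w * y = y * w) : Congruence A :=
  have key : ∀ {x x' y y' : A}, x * w ≤ x' → y * w ≤ y' → x * y * w ≤ x' * y' := by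
    intro x x' y y' hx hy
    calc x * y * w = x * w * (y * w) := by
          rw [mul_assoc x w, ← mul_assoc w, hcomm y, mul_assoc y, hidem, mul_assoc]
      _ ≤ x' * y' := mul_mono hx hy
  have le_w : ∀ {x x' : A}, x ≤ x' → x * w ≤ x' := fun h => by
    simpa using mul_mono h hw
  { rel := fun x y => x * w ≤ y ∧ y * w ≤ x
    iseqv :=
      { refl := fun x => ⟨le_w le_rfl, le_w le_rfl⟩
        symm := And.symm
        trans := by
          have : ∀ {x y z : A}, x * w ≤ y → y * w ≤ z → x * w ≤ z := fun {x y z} h h' => by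
            rw [← hidem, ← mul_assoc]
            exact (mul_mono h le_rfl).trans h'
          exact fun {x y z} h h' => ⟨this h.1 h'.1, this h'.2 h.2⟩ }
    inf := by
      have : ∀ {x x' y y' : A}, x * w ≤ x' → y * w ≤ y' → (x ⊓ y) * w ≤ x' ⊓ y' :=
        fun hx hy => le_inf ((mul_mono inf_le_left le_rfl).trans hx)
          ((mul_mono inf_le_right le_rfl).trans hy)
      exact fun {x x' y y'} h h' => ⟨this h.1 h'.1, this h.2 h'.2⟩
    sup := by
      have : ∀ {x x' y y' : A}, x * w ≤ x' → y * w ≤ y' → (x ⊔ y) * w ≤ x' ⊔ y' :=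
        fun hx hy => sup_mul_le (hx.trans le_sup_left) (hy.trans le_sup_right)
      exact fun {x x' y y'} h h' => ⟨this h.1 h'.1, this h.2 h'.2⟩
    mul := fun h h' => ⟨key h.1 h'.1, key h.2 h'.2⟩
    ldiv := by
      have : ∀ {x x' y y' : A}, x' * w ≤ x → y * w ≤ y' →
          ResiduatedLattice.ldiv x y * w ≤ ResiduatedLattice.ldiv x' y' := by
        intro x x' y y' hx hy
        rw [le_ldiv_iff]
        calc x' * (ResiduatedLattice.ldiv x y * w)
            = x' * w * ResiduatedLattice.ldiv x y * w := by
              rw [mul_assoc x', hcomm, mul_assoc x', mul_assoc _ w w, hidem]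
          _ ≤ x * ResiduatedLattice.ldiv x y * w := mul_mono (mul_mono hx le_rfl) le_rfl
          _ ≤ y * w := mul_mono (mul_ldiv_le x y) le_rfl
          _ ≤ y' := hy
      exact fun {x x' y y'} h h' => ⟨this h.2 h'.1, this h.1 h'.2⟩
    rdiv := by
      have : ∀ {x x' y y' : A}, x * w ≤ x' → y' * w ≤ y →
          ResiduatedLattice.rdiv x y * w ≤ ResiduatedLattice.rdiv x' y' := by
        intro x x' y y' hx hy
        rw [le_rdiv_iff]
        calc ResiduatedLattice.rdiv x y * w * y'
            = ResiduatedLattice.rdiv x y * (y' * w) * w := by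
              rw [mul_assoc, hcomm, mul_assoc, mul_assoc y', hidem]
          _ ≤ ResiduatedLattice.rdiv x y * y * w := mul_mono (mul_mono le_rfl hy) le_rfl
          _ ≤ x * w := mul_mono (rdiv_mul_le x y) le_rfl
          _ ≤ x' := hx
      exact fun {x x' y y'} h h' => ⟨this h.1 h'.2, this h.2 h'.1⟩ }

theorem Congruence.pow {A : Type*} [ResiduatedLattice A] (θ : Congruence A) {x y : A}
    (h : θ.rel x y) (m : ℕ) : θ.rel (x ^ m) (y ^ m) := by
  induction m with
  | zero => simpa using θ.iseqv.refl 1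
  | succ m ih => simpa only [pow_succ] using θ.mul ih h

theorem principalCongruence_iff {A : Type*} [ResiduatedLattice A] {m : ℕ} (hm : m ≠ 0)
    (hidem : ∀ x : A, (1 ⊓ x) ^ m * (1 ⊓ x) ^ m = (1 ⊓ x) ^ m)
    (hcomm : ∀ x y : A, (1 ⊓ x) ^ m * y = y * (1 ⊓ x) ^ m) (a b c d : A) :
    PrincipalCongruence a b c d ↔
      c * (1 ⊓ (ldiv a b ⊓ ldiv b a)) ^ m ≤ d ∧ d * (1 ⊓ (ldiv a b ⊓ ldiv b a)) ^ m ≤ c := by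
  set w := (1 ⊓ (ldiv a b ⊓ ldiv b a)) ^ m with hw
  have hle : w ≤ 1 ⊓ (ldiv a b ⊓ ldiv b a) := by
    simpa using pow_anti (x := 1 ⊓ (ldiv a b ⊓ ldiv b a)) inf_le_left (Nat.one_le_iff_ne_zero.2 hm)
  constructor
  · intro h
    refine h (.ofCentral w (hle.trans inf_le_left) (hidem _) (hcomm _)) ⟨?_, ?_⟩
    · exact (le_ldiv_iff _ _ _).1 (hle.trans (inf_le_right.trans inf_le_left))
    · exact (le_ldiv_iff _ _ _).1 (hle.trans (inf_le_right.trans inf_le_right))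
  · rintro ⟨hcd, hdc⟩ θ hab
    have h₁ : θ.rel w 1 := by
      have hba := θ.iseqv.symm hab
      have h := θ.pow (θ.inf (θ.iseqv.refl 1)
        (θ.inf (θ.ldiv (θ.iseqv.refl a) hba) (θ.ldiv (θ.iseqv.refl b) hab))) m
      rwa [inf_eq_left.2 (le_inf (one_le_ldiv_self a) (one_le_ldiv_self b)), one_pow] at h
    have key : ∀ {x y : A}, x * w ≤ y → θ.rel y (x ⊔ y) := fun {x y} hxy => by
      have h := θ.sup (θ.mul (θ.iseqv.refl x) h₁) (θ.iseqv.refl y)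
      rwa [sup_eq_right.2 hxy, mul_one] at h
    have h₂ := key hdc
    rw [sup_comm] at h₂
    exact θ.iseqv.trans h₂ (θ.iseqv.symm (key hcd))

theorem hasEDPC_of_isHamiltonian {V : Set RLAlg.{u}} {n : ℕ}
    (hn : ∀ A : RLAlg.{u}, A ∈ V → ∀ x : A, (1 ⊓ x) ^ (n + 1) = (1 ⊓ x) ^ n)
    (hV : IsHamiltonian V) : HasEDPC V := by
  obtain ⟨k, hk, hcomm⟩ := hV
  let m := k * (n + 1)
  have hm : m ≠ 0 := by positivity
  have hnm : n ≤ m := n.le_succ.trans (Nat.le_mul_of_pos_left _ hk)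
  let w : RLTerm (Fin 4) := RLTerm.pow (.inf .one (.inf (.ldiv (.var 0) (.var 1))
    (.ldiv (.var 1) (.var 0)))) m
  refine ⟨{leEquation (.mul (.var 2) w) (.var 3), leEquation (.mul (.var 3) w) (.var 2)},
    by simp, fun A hA a b c d => ?_⟩
  have hstable : ∀ x : A, ∀ j, n ≤ j → (1 ⊓ x) ^ j = (1 ⊓ x) ^ n := by
    intro x j hj
    induction j, hj using Nat.le_induction with
    | base => rfl
    | succ j _ ih => rw [pow_succ, ih, ← pow_succ, hn A hA]
  rw [principalCongruence_iff hm]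
  · simp only [Set.mem_insert_iff, Set.mem_singleton_iff, forall_eq_or_imp, forall_eq,
      holds_leEquation, RLTerm.eval, w, RLTerm.eval_pow]
    rfl
  · intro x
    rw [← pow_add, hstable x (m + m) (by omega), hstable x m hnm]
  · intro x y
    have h : Commute ((1 ⊓ x) ^ k) y := hcomm A hA x y
    exact (pow_mul (1 ⊓ x) k (n + 1)).symm ▸ (h.pow_left (n + 1)).eq

end ResiduatedLattice

theorem theorem5p10 (C V : Set ResiduatedLattice.RLAlg.{u})
    (hVariety : ResiduatedLattice.IsVariety V)
    (hISP : V = ResiduatedLattice.ISP C)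
    (hC : ResiduatedLattice.ClosedUnderCanonicalExtensions C)
    (hCoherent : ResiduatedLattice.IsCoherent V) :
    (∃ n : ℕ, ∀ A : ResiduatedLattice.RLAlg.{u}, A ∈ V →
      ∀ x : A, (1 ⊓ x) ^ (n + 1) = (1 ⊓ x) ^ n) ∧
    (ResiduatedLattice.IsHamiltonian V → ResiduatedLattice.HasEDPC V) := by
  subst hISP
  obtain ⟨n, hn⟩ := ResiduatedLattice.exists_pow_succ_eq_pow hVariety hC hCoherent
  exact ⟨⟨n, hn⟩, ResiduatedLattice.hasEDPC_of_isHamiltonian hn⟩
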